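/- Let $H=(V,E)$ be a finite hypergraph, that is, $V$ is a finite set and $E$ is a collection of subsets of $V$; its dimension $\dim H$ is the maximum edge size. For $\emptyset\ne X\subseteq V$ and $j\ge 1$ put $N_j(X,H)=\{Y\subseteq V: X\cup Y\in E,\ X\cap Y=\emptyset,\ |Y|=j\}$ and $d_j(X,H)=|N_j(X,H)|^{1/j}$; put $\Delta_i(H)=\max\{d_{i-|X|}(X,H): X\subseteq V,\ 0<|X|<i\}$ and $\Delta(H)=\max\{\Delta_i(H): 2\le i\le \dim H\}$ (a maximum over an empty set is $0$). One stage of the Beame–Luby algorithm BL on $H$ with marking probability $p$ is the following. Mark every vertex independently with probability $p$; unmark all vertices of each edge that is fully marked; let $I'$ be the set of vertices that are still marked. Remove $I'$ from $V$ and replace each edge $e$ by $e\setminus I'$; discard every edge that properly contains another edge; finally remove every singleton edge $\{v\}$ together with its vertex $v$. Let $H^{+}$ be the resulting hypergraph. Then there are absolute constants $c>0$ and $n_0$ such that the following holds for all $n\ge n_0$ and all integers $d\ge 0$ with $d\le \frac{\log\log n}{4\log\log\log n}$. Let $H=(V,E)$ be any hypergraph with at most $n$ vertices and dimension at most $d$,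 and let $p=1/(a\,\Delta(H))$, where $a=2^{d+1}$ or $a=5d$ (with $p=0$ if $a\,\Delta(H)=0$). With probability at least $1-n^{-c\log n}$, simultaneously for all $2\le j\le d$ and all nonempty $X\subseteq V$ with $|X|<j$, one stage of BL on $H$ increases $d_{j-|X|}(X,H)$ by less than $\sum_{k=j+1}^{d}(\log n)^{2(k-j)}\Delta_k(H)$, that is, $$d_{j-|X|}(X,H^{+})-d_{j-|X|}(X,H)<\sum_{k=j+1}^{d}(\log n)^{2(k-j)}\,\Delta_k(H),$$ where $<$ is replaced by $\le$ if the right-hand side is $0$ (that is, if $H$ has no edge of size larger than $j$). Here $\log$ is the natural logarithm. -/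

import Mathlib

open scoped NNReal

/-- A finite hypergraph: a finite vertex set and a finite collection of subsets of it. -/
structure FinHypergraph (α : Type*) where
  verts : Finset α
  edges : Finset (Finset α)
  edge_subset : ∀ e ∈ edges, e ⊆ verts

namespace FinHypergraph

variable {α : Type*} [DecidableEq α]

/-- The dimension: the maximum edge size. -/
def dim (H : FinHypergraph α) : ℕ := H.edges.sup Finset.card

/-- `N_j(x, H)`: the sets `y ⊆ V` of size `j`, disjoint from `x`, with `x ∪ y` an edge. -/
def nbr (H : FinHypergraph α) (j : ℕ) (x : Finset α) : Finset (Finset α) :=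
  H.verts.powerset.filter fun y => x ∪ y ∈ H.edges ∧ Disjoint x y ∧ y.card = j

/-- The normalized degree `d_j(x, H) = |N_j(x, H)| ^ (1 / j)`, used for `j ≥ 1` only. -/
noncomputable def normDeg (H : FinHypergraph α) (j : ℕ) (x : Finset α) : ℝ≥0 :=
  ((H.nbr j x).card : ℝ≥0) ^ (1 / (j : ℝ))

/-- `Δ_i(H)`: the maximum of `d_{i - |x|}(x, H)` over `x ⊆ V` with `0 < |x| < i`. -/
noncomputable def maxDeg (H : FinHypergraph α) (i : ℕ) : ℝ≥0 :=
  (H.verts.powerset.filter fun x => 0 < x.card ∧ x.card < i).sup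
    fun x => H.normDeg (i - x.card) x

/-- `Δ(H)`: the maximum of `Δ_i(H)` over `2 ≤ i ≤ dim H`. -/
noncomputable def totalMaxDeg (H : FinHypergraph α) : ℝ≥0 :=
  (Finset.Icc 2 H.dim).sup H.maxDeg

/-- The set `I'` that a stage adds to the independent set when `S` is the set of marked vertices:
every vertex of a fully marked edge is unmarked. -/
def added (H : FinHypergraph α) (S : Finset α) : Finset α :=
  S.filter fun v => ∀ e ∈ H.edges, e ⊆ S → v ∉ e

/-- The edges after the vertices in `I'` have been deleted from each of them. -/
def trimmed (H : FinHypergraph α) (S : Finset α) : Finset (Finset α) :=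
  H.edges.image fun e => e \ H.added S

/-- The trimmed edges that contain no smaller trimmed edge. -/
def minimalTrimmed (H : FinHypergraph α) (S : Finset α) : Finset (Finset α) :=
  (H.trimmed S).filter fun e => ∀ f ∈ H.trimmed S, f ⊆ e → f = e

/-- The hypergraph after one stage of the Beame–Luby algorithm in which exactly the vertices in
`S` were marked: the vertices of `I'` are removed and the edges trimmed, edges that contain a
smaller edge are discarded, and then every singleton edge is removed together with its vertex. -/
def stage (H : FinHypergraph α) (S : Finset α) : FinHypergraph α where
  verts := (H.verts \ H.added S).filter fun v => {v} ∉ H.minimalTrimmed S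
  edges := (H.minimalTrimmed S).filter fun e => e.card ≠ 1
  edge_subset := by
    intro e he v hv
    simp only [minimalTrimmed, Finset.mem_filter] at he ⊢
    obtain ⟨⟨heT, hmin⟩, hcard⟩ := he
    refine ⟨?_, ?_⟩
    · obtain ⟨f, hf, rfl⟩ := Finset.mem_image.1 heT
      exact Finset.sdiff_subset_sdiff (H.edge_subset f hf) subset_rfl hv
    · rintro ⟨hvT, -⟩
      have h := hmin {v} hvT (Finset.singleton_subset_iff.2 hv)
      exact hcard (h ▸ Finset.card_singleton v)

open Classical in
/-- The probability of the event `P` for the random set of marked vertices, where each vertex of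
`H` is marked independently with probability `p`. -/
noncomputable def markProb (H : FinHypergraph α) (p : ℝ) (P : Finset α → Prop) : ℝ :=
  ∑ S ∈ H.verts.powerset.filter P, p ^ S.card * (1 - p) ^ (H.verts \ S).card

/-- The change of `d_{j - |X|}(X, H)` in the stage in which the vertices in `S` were marked. -/
noncomputable def increase (H : FinHypergraph α) (S : Finset α) (j : ℕ) (X : Finset α) : ℝ :=
  ((H.stage S).normDeg (j - X.card) X : ℝ) - (H.normDeg (j - X.card) X : ℝ)

/-- `∑_{k > j} (log n) ^ (2 (k - j)) * Δ_k(H)`, where `k` runs up to `d`. -/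
noncomputable def migrationBound (H : FinHypergraph α) (n d j : ℕ) : ℝ :=
  ∑ k ∈ Finset.Ioc j d, Real.log n ^ (2 * (k - j)) * (H.maxDeg k : ℝ)

end FinHypergraph

/-!
Fix `j < k` and `X`. The number of edges of size `k` that can shrink to an edge of size `j`
containing `X` is a homogeneous polynomial of degree `q = k - j` in the marking indicators. Since
`p * (k * Δ_k) ≤ 1`, all its partial expectations are at most `M = Δ_k ^ (j - |X|)`. Its moments are
bounded by revealing one monomial at a time: given that a set of fewer than `K` vertices is marked,
the conditional expectation of the polynomial is at most `K ^ q * M`. Markov's inequality for the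
moment of order about `R / (e * q)` then shows that the polynomial exceeds `R ^ q * M` with
probability at most `exp (q - R / e)`. For `R = (log n) ^ 2` this beats the number of triples
`(j, k, X)`, which is at most `(d + 1) ^ 2 * (n + 1) ^ d`. Finally, subadditivity of
`x ↦ x ^ (1 / (j - |X|))` allows us to add up the contributions of all `k`.
-/

section RandomSubset

open Finset

variable {α ι : Type*} [DecidableEq α] {V : Finset α} {p : ℝ}

/-- The expectation of `f S` for the random subset `S` of `V` that contains each element of `V`
independently with probability `p`. It is defined for every real `p`, and is a positive functional
for `p ∈ [0, 1]`. -/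
noncomputable def subsetExp (V : Finset α) (p : ℝ) (f : Finset α → ℝ) : ℝ :=
  ∑ S ∈ V.powerset, p ^ #S * (1 - p) ^ #(V \ S) * f S

open Classical in
/-- The probability of `P S` for the random subset `S` of `V` that contains each element of `V`
independently with probability `p`. -/
noncomputable def subsetProb (V : Finset α) (p : ℝ) (P : Finset α → Prop) : ℝ :=
  subsetExp V p fun S => if P S then 1 else 0

lemma subsetExp_mono (hp : p ∈ Set.Icc 0 1) {f g : Finset α → ℝ} (hfg : ∀ S, f S ≤ g S) :
    subsetExp V p f ≤ subsetExp V p g :=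
  sum_le_sum fun S _ => mul_le_mul_of_nonneg_left (hfg S) <|
    mul_nonneg (pow_nonneg hp.1 _) (pow_nonneg (sub_nonneg.2 hp.2) _)

lemma subsetExp_add (f g : Finset α → ℝ) :
    subsetExp V p (fun S => f S + g S) = subsetExp V p f + subsetExp V p g := by
  simp only [subsetExp, mul_add, sum_add_distrib]

lemma subsetExp_sum (I : Finset ι) (f : ι → Finset α → ℝ) :
    subsetExp V p (fun S => ∑ i ∈ I, f i S) = ∑ i ∈ I, subsetExp V p (f i) := by
  simp only [subsetExp, mul_sum]
  exact sum_comm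

lemma subsetExp_mul_const (f : Finset α → ℝ) (c : ℝ) :
    subsetExp V p (fun S => f S * c) = subsetExp V p f * c := by
  simp only [subsetExp, sum_mul, mul_assoc]

lemma subsetExp_indicator_superset {U : Finset α} (hU : U ⊆ V) :
    subsetExp V p (fun S => if U ⊆ S then 1 else 0) = p ^ #U := by
  -- Expand `∏ v ∈ V, (p + q v)`, where `q v` is `0` on `U` and `1 - p` elsewhere.
  have hprod : ∏ v ∈ V, (p + if v ∈ U then 0 else 1 - p) = p ^ #U := by
    have hfactor : ∀ v ∈ V, (p + if v ∈ U then 0 else 1 - p) = if v ∈ U then p else 1 := by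
      intro v _
      split_ifs <;> ring
    rw [prod_congr rfl hfactor, prod_ite_mem, inter_eq_right.2 hU, prod_const]
  rw [← hprod, prod_add]
  refine sum_congr rfl fun S _ => ?_
  rw [prod_const, mul_assoc]
  congr 1
  beta_reduce
  split_ifs with hUS
  · rw [mul_one, ← prod_const]
    exact prod_congr rfl fun v hv => (if_neg fun hvU => (mem_sdiff.1 hv).2 (hUS hvU)).symm
  · obtain ⟨v, hvU, hvS⟩ := not_subset.1 hUS
    rw [mul_zero, eq_comm]
    exact prod_eq_zero (i := v) (mem_sdiff.2 ⟨hU hvU, hvS⟩) (if_pos hvU)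

lemma subsetExp_one : subsetExp V p (fun _ => 1) = 1 := by
  simpa using subsetExp_indicator_superset (p := p) (empty_subset V)

lemma subsetProb_mono (hp : p ∈ Set.Icc 0 1) {P Q : Finset α → Prop} (hPQ : ∀ S, P S → Q S) :
    subsetProb V p P ≤ subsetProb V p Q := by
  refine subsetExp_mono hp fun S => ?_
  by_cases hP : P S
  · simp only [hP, hPQ S hP, le_refl]
  · rw [if_neg hP]
    split_ifs <;> norm_num

lemma subsetProb_mul_le_subsetExp (hp : p ∈ Set.Icc 0 1) {f : Finset α → ℝ} (hf : ∀ S, 0 ≤ f S)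
    (t : ℝ) : subsetProb V p (fun S => t ≤ f S) * t ≤ subsetExp V p f := by
  rw [subsetProb, ← subsetExp_mul_const]
  refine subsetExp_mono hp fun S => ?_
  split_ifs with h
  · rwa [one_mul]
  · rw [zero_mul]
    exact hf S

lemma one_sub_sum_subsetProb_le (hp : p ∈ Set.Icc 0 1) (B : Finset ι) (Q : ι → Finset α → Prop) :
    1 - ∑ b ∈ B, subsetProb V p (Q b) ≤ subsetProb V p (fun S => ∀ b ∈ B, ¬ Q b S) := by
  classical
  rw [sub_le_iff_le_add, ← subsetExp_one (V := V) (p := p)]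
  simp only [subsetProb]
  rw [← subsetExp_sum, ← subsetExp_add]
  refine subsetExp_mono hp fun S => ?_
  have hnonneg : ∀ b ∈ B, (0 : ℝ) ≤ if Q b S then 1 else 0 := fun b _ => by positivity
  by_cases hS : ∀ b ∈ B, ¬ Q b S
  · rw [if_pos hS]
    exact le_add_of_nonneg_right (sum_nonneg hnonneg)
  · rw [if_neg hS, zero_add]
    push Not at hS
    obtain ⟨b, hb, hQ⟩ := hS
    simpa only [hQ, if_true] using single_le_sum hnonneg hb

end RandomSubset

section PartialExpectations

open Finset

lemma card_powerset_filter_card_le {α : Type*} (U : Finset α) (q : ℕ) :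
    #{T ∈ U.powerset | #T ≤ q} ≤ (#U + 1) ^ q := by
  classical
  have hcover : {T ∈ U.powerset | #T ≤ q} ⊆ (range (q + 1)).biUnion fun t => U.powersetCard t := by
    intro T hT
    rw [mem_filter, mem_powerset] at hT
    exact mem_biUnion.2 ⟨#T, mem_range.2 (Nat.lt_succ_of_le hT.2), mem_powersetCard.2 ⟨hT.1, rfl⟩⟩
  calc #{T ∈ U.powerset | #T ≤ q}
      ≤ ∑ t ∈ range (q + 1), #(U.powersetCard t) := (card_le_card hcover).trans card_biUnion_le
    _ ≤ ∑ t ∈ range (q + 1), #U ^ t * 1 ^ (q - t) * q.choose t := by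
        refine sum_le_sum fun t ht => ?_
        rw [card_powersetCard, one_pow, mul_one]
        exact (Nat.choose_le_pow _ _).trans
          (Nat.le_mul_of_pos_right _ (Nat.choose_pos (mem_range_succ_iff.1 ht)))
    _ = (#U + 1) ^ q := (add_pow _ _ _).symm

variable {α ι : Type*} [DecidableEq α] {V : Finset α} {p M : ℝ} {q : ℕ} {I : Finset ι}
  {z : ι → Finset α}

/-- The sets `z i`, `i ∈ I`, are `q`-subsets of `V`, and all partial expectations of the polynomial
`∑ i ∈ I, ∏ v ∈ z i, x v` with respect to independent Bernoulli variables `x v` of mean `p` are at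
most `M`: the partial derivative at a set `T` of variables has `#{i ∈ I | T ⊆ z i}` monomials, each
of degree `q - #T`. -/
structure PartialExpBounded (V : Finset α) (p M : ℝ) (q : ℕ) (I : Finset ι)
    (z : ι → Finset α) : Prop where
  subset : ∀ i ∈ I, z i ⊆ V
  card_eq : ∀ i ∈ I, #(z i) = q
  card_mul_pow_le : ∀ T, #{i ∈ I | T ⊆ z i} * p ^ (q - #T) ≤ M

namespace PartialExpBounded

lemma nonneg (h : PartialExpBounded V p M q I z) (hp : 0 ≤ p) : 0 ≤ M :=
  (by positivity : 0 ≤ #{i ∈ I | ∅ ⊆ z i} * p ^ (q - #(∅ : Finset α))).trans (h.card_mul_pow_le ∅)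

/- The left-hand side is the conditional expectation of the number of sets `z i` in the random set,
given that the random set contains `U`; split it according to the intersections `z i ∩ U`. -/
lemma sum_pow_card_sdiff_le (h : PartialExpBounded V p M q I z) (hp : 0 ≤ p) (U : Finset α) :
    ∑ i ∈ I, p ^ #(z i \ U) ≤ (#U + 1 : ℝ) ^ q * M := by
  have hmaps : ∀ i ∈ I, z i ∩ U ∈ {T ∈ U.powerset | #T ≤ q} := fun i hi =>
    mem_filter.2 ⟨mem_powerset.2 inter_subset_right,
      (card_le_card inter_subset_left).trans (h.card_eq i hi).le⟩
  have hfiber : ∀ T ∈ {T ∈ U.powerset | #T ≤ q},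
      ∑ i ∈ I with z i ∩ U = T, p ^ #(z i \ U) ≤ M := by
    intro T _
    have hterm : ∀ i ∈ {i ∈ I | z i ∩ U = T}, p ^ #(z i \ U) = p ^ (q - #T) := by
      intro i hi
      obtain ⟨hiI, rfl⟩ := mem_filter.1 hi
      rw [card_sdiff, inter_comm, h.card_eq i hiI]
    calc ∑ i ∈ I with z i ∩ U = T, p ^ #(z i \ U)
        = #{i ∈ I | z i ∩ U = T} * p ^ (q - #T) := by
          rw [sum_congr rfl hterm, sum_const, nsmul_eq_mul]
      _ ≤ #{i ∈ I | T ⊆ z i} * p ^ (q - #T) := by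
          gcongr with i
          rintro rfl
          exact inter_subset_left
      _ ≤ M := h.card_mul_pow_le T
  calc ∑ i ∈ I, p ^ #(z i \ U)
      = ∑ T ∈ U.powerset with #T ≤ q, ∑ i ∈ I with z i ∩ U = T, p ^ #(z i \ U) :=
        (sum_fiberwise_of_maps_to hmaps _).symm
    _ ≤ #{T ∈ U.powerset | #T ≤ q} * M := by
        simpa only [nsmul_eq_mul] using sum_le_card_nsmul _ _ _ hfiber
    _ ≤ (#U + 1 : ℝ) ^ q * M :=
        mul_le_mul_of_nonneg_right (mod_cast card_powerset_filter_card_le U q) (h.nonneg hp)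

end PartialExpBounded

lemma indicator_mul_card_pow_succ (I : Finset ι) (z : ι → Finset α) (U S : Finset α) (m : ℕ) :
    (if U ⊆ S then (1 : ℝ) else 0) * (#{i ∈ I | z i ⊆ S} : ℝ) ^ (m + 1) =
      ∑ i ∈ I, (if U ∪ z i ⊆ S then 1 else 0) * (#{i ∈ I | z i ⊆ S} : ℝ) ^ m := by
  simp only [union_subset_iff, ite_and]
  rw [← sum_mul, pow_succ', ← mul_assoc]
  congr 1
  split_ifs <;> simp

namespace PartialExpBounded

/- Peel off one factor of the `m`-th power at a time: this replaces `U` by `U ∪ z i`, which never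
has more than `K` elements. -/
lemma subsetExp_indicator_mul_card_pow_le (h : PartialExpBounded V p M q I z) (hp : 0 ≤ p)
    (hq : 1 ≤ q) {K : ℝ} (m : ℕ) {U : Finset α} (hU : U ⊆ V) (hK : #U + q * m ≤ K) :
    subsetExp V p (fun S => (if U ⊆ S then 1 else 0) * (#{i ∈ I | z i ⊆ S} : ℝ) ^ m) ≤
      p ^ #U * (M * K ^ q) ^ m := by
  have hM := h.nonneg hp
  induction m generalizing U with
  | zero => simpa only [pow_zero, mul_one] using (subsetExp_indicator_superset hU).le
  | succ m ih =>
    have hq' : (1 : ℝ) ≤ q := by exact_mod_cast hq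
    have hqm : (0 : ℝ) ≤ q * m := by positivity
    push_cast at hK
    have hUK : (#U + 1 : ℝ) ≤ K := by linarith
    have hK0 : 0 ≤ K := le_trans (by positivity) hUK
    have hstep : ∀ i ∈ I, subsetExp V p (fun S =>
        (if U ∪ z i ⊆ S then 1 else 0) * (#{i ∈ I | z i ⊆ S} : ℝ) ^ m) ≤
          p ^ #(z i \ U) * (p ^ #U * (M * K ^ q) ^ m) := by
      intro i hi
      have hcard : (#(U ∪ z i) : ℝ) ≤ #U + q := by
        exact_mod_cast (card_union_le U (z i)).trans (by rw [h.card_eq i hi])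
      refine (ih (union_subset hU (h.subset i hi)) (by linarith)).trans_eq ?_
      rw [union_comm, ← card_sdiff_add_card, pow_add, mul_assoc]
    have hcond : ∑ i ∈ I, p ^ #(z i \ U) ≤ M * K ^ q :=
      calc ∑ i ∈ I, p ^ #(z i \ U) ≤ (#U + 1 : ℝ) ^ q * M := h.sum_pow_card_sdiff_le hp U
        _ ≤ K ^ q * M := by gcongr
        _ = M * K ^ q := mul_comm _ _
    simp only [indicator_mul_card_pow_succ]
    rw [subsetExp_sum]
    calc _ ≤ ∑ i ∈ I, p ^ #(z i \ U) * (p ^ #U * (M * K ^ q) ^ m) := sum_le_sum hstep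
      _ = (∑ i ∈ I, p ^ #(z i \ U)) * (p ^ #U * (M * K ^ q) ^ m) := (sum_mul ..).symm
      _ ≤ M * K ^ q * (p ^ #U * (M * K ^ q) ^ m) := by gcongr
      _ = p ^ #U * (M * K ^ q) ^ (m + 1) := by ring

lemma subsetProb_le_exp_neg (h : PartialExpBounded V p M q I z) (hp : p ∈ Set.Icc 0 1)
    (hq : 1 ≤ q) (hM : 0 < M) {K : ℝ} (hK : 0 < K) {m : ℕ} (hm : q * m ≤ K) :
    subsetProb V p (fun S => M * (Real.exp 1 * K) ^ q ≤ #{i ∈ I | z i ⊆ S}) ≤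
      Real.exp (-(q * m)) := by
  set t := M * (Real.exp 1 * K) ^ q with ht
  have hmoment : subsetExp V p (fun S => (#{i ∈ I | z i ⊆ S} : ℝ) ^ m) ≤ (M * K ^ q) ^ m := by
    simpa using h.subsetExp_indicator_mul_card_pow_le hp.1 hq m (empty_subset V) (by simpa using hm)
  have hpow : t ^ m = (M * K ^ q) ^ m / Real.exp (-(q * m)) := by
    rw [ht, Real.exp_neg, div_inv_eq_mul, mul_pow (Real.exp 1), mul_left_comm, mul_pow (_ ^ q),
      ← pow_mul, ← Real.exp_nat_mul, mul_one, mul_comm]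
    push_cast
    rfl
  have hmarkov : subsetProb V p (fun S => t ≤ #{i ∈ I | z i ⊆ S}) * t ^ m ≤ (M * K ^ q) ^ m :=
    calc _ ≤ subsetProb V p (fun S => t ^ m ≤ (#{i ∈ I | z i ⊆ S} : ℝ) ^ m) * t ^ m :=
          mul_le_mul_of_nonneg_right
            (subsetProb_mono hp fun S hS => pow_le_pow_left₀ (by positivity) hS m) (by positivity)
      _ ≤ _ := (subsetProb_mul_le_subsetExp hp (fun S => by positivity) _).trans hmoment
  rw [hpow, mul_div_assoc', div_le_iff₀ (Real.exp_pos _), mul_comm] at hmarkov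
  exact le_of_mul_le_mul_left hmarkov (by positivity)

lemma subsetProb_le_exp_sub (h : PartialExpBounded V p M q I z) (hp : p ∈ Set.Icc 0 1)
    (hq : 1 ≤ q) (hM : 0 < M) {R : ℝ} (hR : 0 < R) :
    subsetProb V p (fun S => M * R ^ q ≤ #{i ∈ I | z i ⊆ S}) ≤ Real.exp (q - R / Real.exp 1) := by
  have hq' : (0 : ℝ) < q := by exact_mod_cast hq
  set K := R / Real.exp 1
  have hK : 0 < K := by positivity
  have hR_eq : R = Real.exp 1 * K := (mul_div_cancel₀ R (Real.exp_pos 1).ne').symm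
  have hfloor_le : q * (⌊K / q⌋₊ : ℝ) ≤ K := by
    rw [← le_div_iff₀' hq']
    exact Nat.floor_le (by positivity)
  have hlt_floor : K < q * ((⌊K / q⌋₊ : ℝ) + 1) := by
    rw [← div_lt_iff₀' hq']
    exact Nat.lt_floor_add_one _
  rw [hR_eq]
  exact (h.subsetProb_le_exp_neg hp hq hM hK hfloor_le).trans
    (Real.exp_le_exp.2 (by linarith))

end PartialExpBounded

end PartialExpectations

namespace FinHypergraph

open Finset

section Degrees

lemma card_le_dim {α : Type*} {H : FinHypergraph α} {e : Finset α} (he : e ∈ H.edges) :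
    #e ≤ H.dim :=
  le_sup (f := card) he

variable {α : Type*} [DecidableEq α] {H : FinHypergraph α} {j k : ℕ} {X Y : Finset α}

lemma mem_nbr : Y ∈ H.nbr j X ↔ Y ⊆ H.verts ∧ X ∪ Y ∈ H.edges ∧ Disjoint X Y ∧ #Y = j := by
  rw [nbr, mem_filter, mem_powerset]

lemma one_le_normDeg (h : (H.nbr j X).Nonempty) : 1 ≤ H.normDeg j X :=
  NNReal.one_le_rpow (by exact_mod_cast h.card_pos) (by positivity)

lemma nbr_nonempty_of_normDeg_pos (hj : j ≠ 0) (h : 0 < H.normDeg j X) :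
    (H.nbr j X).Nonempty := by
  contrapose! h
  rw [normDeg, h, card_empty, Nat.cast_zero, NNReal.zero_rpow (by positivity)]

lemma normDeg_le_maxDeg (hX : X ⊆ H.verts) (hXne : X.Nonempty) (hXk : #X < k) :
    H.normDeg (k - #X) X ≤ H.maxDeg k :=
  le_sup (f := fun x => H.normDeg (k - #x) x)
    (mem_filter.2 ⟨mem_powerset.2 hX, hXne.card_pos, hXk⟩)

lemma card_nbr_le_maxDeg_pow (hX : X ⊆ H.verts) (hXne : X.Nonempty) (hXk : #X < k) :
    (#(H.nbr (k - #X) X) : ℝ) ≤ (H.maxDeg k : ℝ) ^ (k - #X) := by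
  have h := pow_le_pow_left₀ zero_le (normDeg_le_maxDeg hX hXne hXk) (k - #X)
  rw [normDeg, one_div, NNReal.rpow_inv_natCast_pow _ (by lia)] at h
  exact_mod_cast h

lemma exists_nbr_nonempty_of_maxDeg_pos (h : 0 < H.maxDeg k) :
    ∃ X ⊆ H.verts, X.Nonempty ∧ #X < k ∧ (H.nbr (k - #X) X).Nonempty := by
  obtain ⟨X, hX, hpos⟩ := Finset.lt_sup_iff.1 h
  obtain ⟨hXV, hX0, hXk⟩ := mem_filter.1 hX
  exact ⟨X, mem_powerset.1 hXV, card_pos.1 hX0, hXk, nbr_nonempty_of_normDeg_pos (by lia) hpos⟩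

lemma one_le_maxDeg_of_pos (h : 0 < H.maxDeg k) : 1 ≤ H.maxDeg k := by
  obtain ⟨X, hX, hXne, hXk, hnbr⟩ := exists_nbr_nonempty_of_maxDeg_pos h
  exact (one_le_normDeg hnbr).trans (normDeg_le_maxDeg hX hXne hXk)

lemma le_dim_of_maxDeg_pos (h : 0 < H.maxDeg k) : k ≤ H.dim := by
  obtain ⟨X, -, -, hXk, Y, hY⟩ := exists_nbr_nonempty_of_maxDeg_pos h
  obtain ⟨-, he, hXY, hYcard⟩ := mem_nbr.1 hY
  calc k = #(X ∪ Y) := by rw [card_union_of_disjoint hXY]; lia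
    _ ≤ H.dim := card_le_dim he

lemma maxDeg_le_totalMaxDeg (hk : 2 ≤ k) : H.maxDeg k ≤ H.totalMaxDeg := by
  rcases (zero_le (a := H.maxDeg k)).eq_or_lt with h | h
  · rw [← h]
    exact zero_le
  · exact le_sup (mem_Icc.2 ⟨hk, le_dim_of_maxDeg_pos h⟩)

lemma one_le_dim_mul_totalMaxDeg (h : 0 < H.totalMaxDeg) : 1 ≤ (H.dim : ℝ) * H.totalMaxDeg := by
  obtain ⟨k, hk, hpos⟩ := Finset.lt_sup_iff.1 h
  obtain ⟨hk2, hkd⟩ := mem_Icc.1 hk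
  have hdim : (1 : ℝ) ≤ H.dim := by exact_mod_cast (by lia : 1 ≤ H.dim)
  have hmax : (1 : ℝ) ≤ H.totalMaxDeg :=
    mod_cast (one_le_maxDeg_of_pos hpos).trans (maxDeg_le_totalMaxDeg hk2)
  exact one_le_mul_of_one_le_of_one_le hdim hmax

lemma mul_maxDeg_le_dim_mul_totalMaxDeg (hk : 2 ≤ k) :
    (k : ℝ) * H.maxDeg k ≤ H.dim * H.totalMaxDeg := by
  rcases (zero_le (a := H.maxDeg k)).eq_or_lt with h | h
  · rw [← h, NNReal.coe_zero, mul_zero]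
    positivity
  · have := maxDeg_le_totalMaxDeg (H := H) hk
    have := le_dim_of_maxDeg_pos h
    gcongr

end Degrees

section Migration

variable {α : Type*} [DecidableEq α] {H : FinHypergraph α} {d j k : ℕ} {X : Finset α}

/-- The possible migrations of edges of size `k` to edges of size `j` containing `X`: the pairs
`⟨W, Z⟩` with `Z ⊆ W` for which `X ∪ W` is an edge of size `k` that shrinks to the set
`X ∪ (W \ Z)` of size `j` when `Z` is removed. -/
def migrations (H : FinHypergraph α) (k j : ℕ) (X : Finset α) :
    Finset (Σ _ : Finset α, Finset α) :=
  (H.nbr (k - #X) X).sigma fun W => W.powersetCard (k - j)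

lemma mem_migrations {w : Σ _ : Finset α, Finset α} :
    w ∈ H.migrations k j X ↔ w.1 ∈ H.nbr (k - #X) X ∧ w.2 ⊆ w.1 ∧ #w.2 = k - j := by
  rw [migrations, mem_sigma, mem_powersetCard]

lemma card_migrations :
    #(H.migrations k j X) = #(H.nbr (k - #X) X) * (k - #X).choose (k - j) := by
  rw [migrations, card_sigma]
  refine sum_const_nat fun W hW => ?_
  rw [card_powersetCard, (mem_nbr.1 hW).2.2.2]

lemma card_filter_subset_migrations_le {T : Finset α} (hXT : Disjoint X T) :
    #{w ∈ H.migrations k j X | T ⊆ w.2} ≤ #(H.migrations k (j + #T) (X ∪ T)) := by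
  refine card_le_card_of_injOn (fun w => ⟨w.1 \ T, w.2 \ T⟩) ?_ ?_
  · intro w hw
    obtain ⟨hw, hTZ⟩ := mem_filter.1 (mem_coe.1 hw)
    obtain ⟨hW, hZW, hZcard⟩ := mem_migrations.1 hw
    obtain ⟨hWV, hWe, hXW, hWcard⟩ := mem_nbr.1 hW
    have hTW := hTZ.trans hZW
    refine mem_coe.2 (mem_migrations.2 ⟨mem_nbr.2 ⟨sdiff_subset.trans hWV, ?_, ?_, ?_⟩,
      sdiff_subset_sdiff hZW subset_rfl, ?_⟩)
    · rwa [union_assoc, union_sdiff_of_subset hTW]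
    · exact disjoint_union_left.2 ⟨hXW.mono_right sdiff_subset, disjoint_sdiff⟩
    · rw [card_sdiff_of_subset hTW, hWcard, card_union_of_disjoint hXT, Nat.sub_sub]
    · rw [card_sdiff_of_subset hTZ, hZcard, Nat.sub_sub]
  · rintro ⟨W, Z⟩ hw ⟨W', Z'⟩ hw' h
    obtain ⟨hw, hTZ⟩ := mem_filter.1 (mem_coe.1 hw)
    obtain ⟨hw', hTZ'⟩ := mem_filter.1 (mem_coe.1 hw')
    have hTW : T ⊆ W := hTZ.trans (mem_migrations.1 hw).2.1
    have hTW' : T ⊆ W' := hTZ'.trans (mem_migrations.1 hw').2.1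
    change T ⊆ Z at hTZ
    change T ⊆ Z' at hTZ'
    simp only [Sigma.mk.injEq, heq_eq_eq] at h ⊢
    exact ⟨by rw [← union_sdiff_of_subset hTW, h.1, union_sdiff_of_subset hTW'],
      by rw [← union_sdiff_of_subset hTZ, h.2, union_sdiff_of_subset hTZ']⟩

lemma card_migrations_mul_pow_le {p : ℝ} (hp0 : 0 ≤ p) (hp : p * (k * H.maxDeg k) ≤ 1)
    (hX : X ⊆ H.verts) (hXne : X.Nonempty) (hXj : #X ≤ j) (hjk : j ≤ k) (hXk : #X < k) :
    #(H.migrations k j X) * p ^ (k - j) ≤ (H.maxDeg k : ℝ) ^ (j - #X) := by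
  have hchoose : ((k - #X).choose (k - j) : ℝ) ≤ (k : ℝ) ^ (k - j) := by
    exact_mod_cast (Nat.choose_le_pow _ _).trans (Nat.pow_le_pow_left (Nat.sub_le k #X) _)
  calc #(H.migrations k j X) * p ^ (k - j)
      ≤ (H.maxDeg k : ℝ) ^ (k - #X) * k ^ (k - j) * p ^ (k - j) := by
        rw [card_migrations, Nat.cast_mul]
        gcongr
        exact card_nbr_le_maxDeg_pow hX hXne hXk
    _ = (H.maxDeg k : ℝ) ^ (j - #X) * (p * (k * H.maxDeg k)) ^ (k - j) := by
        rw [(by lia : k - #X = (j - #X) + (k - j))]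
        ring
    _ ≤ (H.maxDeg k : ℝ) ^ (j - #X) :=
        mul_le_of_le_one_right (by positivity) (pow_le_one₀ (by positivity) hp)

lemma partialExpBounded_migrations {p : ℝ} (hp0 : 0 ≤ p) (hp : p * (k * H.maxDeg k) ≤ 1)
    (hX : X ⊆ H.verts) (hXne : X.Nonempty) (hXj : #X < j) (hjk : j ≤ k) :
    PartialExpBounded H.verts p ((H.maxDeg k : ℝ) ^ (j - #X)) (k - j) (H.migrations k j X)
      Sigma.snd where
  subset w hw := by
    obtain ⟨hW, hZW, -⟩ := mem_migrations.1 hw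
    exact hZW.trans (mem_nbr.1 hW).1
  card_eq w hw := (mem_migrations.1 hw).2.2
  card_mul_pow_le T := by
    rcases eq_empty_or_nonempty {w ∈ H.migrations k j X | T ⊆ w.2} with hempty | ⟨w, hw⟩
    · rw [hempty, card_empty, Nat.cast_zero, zero_mul]
      positivity
    obtain ⟨hw, hTZ⟩ := mem_filter.1 hw
    obtain ⟨hW, hZW, hZcard⟩ := mem_migrations.1 hw
    obtain ⟨hWV, -, hXW, -⟩ := mem_nbr.1 hW
    have hTW := hTZ.trans hZW
    have hXT : Disjoint X T := hXW.mono_right hTW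
    have hTcard := card_le_card hTZ
    have hXTcard := card_union_of_disjoint hXT
    calc #{w ∈ H.migrations k j X | T ⊆ w.2} * p ^ (k - j - #T)
        ≤ #(H.migrations k (j + #T) (X ∪ T)) * p ^ (k - (j + #T)) := by
          rw [Nat.sub_sub]
          exact mul_le_mul_of_nonneg_right
            (Nat.cast_le.2 (card_filter_subset_migrations_le hXT)) (by positivity)
      _ ≤ (H.maxDeg k : ℝ) ^ (j + #T - #(X ∪ T)) :=
          card_migrations_mul_pow_le hp0 hp (union_subset hX (hTW.trans hWV))
            (hXne.mono subset_union_left) (by lia) (by lia) (by lia)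
      _ = (H.maxDeg k : ℝ) ^ (j - #X) := by rw [hXTcard, Nat.add_sub_add_right]

/-- The migrations that a stage can perform when `S` is the set of marked vertices. -/
def migrated (H : FinHypergraph α) (S : Finset α) (k j : ℕ) (X : Finset α) :
    Finset (Σ _ : Finset α, Finset α) :=
  {w ∈ H.migrations k j X | w.2 ⊆ S}

lemma exists_union_mem_edges_of_mem_stage_edges {S f : Finset α} (hf : f ∈ (H.stage S).edges) :
    ∃ Z ⊆ S, Disjoint f Z ∧ f ∪ Z ∈ H.edges := by
  obtain ⟨e, he, rfl⟩ := mem_image.1 (mem_filter.1 (mem_filter.1 hf).1).1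
  refine ⟨e ∩ H.added S, inter_subset_right.trans (filter_subset _ _),
    disjoint_sdiff_inter e _, ?_⟩
  rwa [sdiff_union_inter]

lemma stage_verts_subset (S : Finset α) : (H.stage S).verts ⊆ H.verts :=
  (filter_subset _ _).trans sdiff_subset

lemma nbr_stage_subset (hd : H.dim ≤ d) (hXj : #X < j) (S : Finset α) :
    (H.stage S).nbr (j - #X) X ⊆ H.nbr (j - #X) X ∪
      (Ioc j d).biUnion fun k => (H.migrated S k j X).image fun w => w.1 \ w.2 := by
  intro Y hY
  obtain ⟨hYV, hXYe, hXY, hYcard⟩ := mem_nbr.1 hY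
  replace hYV := hYV.trans (stage_verts_subset S)
  obtain ⟨Z, hZS, hdisj, he⟩ := exists_union_mem_edges_of_mem_stage_edges hXYe
  have hecard := card_union_of_disjoint hdisj
  have hed := (card_le_dim he).trans hd
  rw [card_union_of_disjoint hXY] at hecard
  obtain ⟨hXZ, hYZ⟩ := disjoint_union_left.1 hdisj
  rw [union_assoc] at he
  rcases Z.eq_empty_or_nonempty with rfl | hZne
  · rw [union_empty] at he
    exact mem_union_left _ (mem_nbr.2 ⟨hYV, he, hXY, hYcard⟩)
  · have hZpos := hZne.card_pos
    have hYZV : Y ∪ Z ⊆ H.verts := subset_union_right.trans (H.edge_subset _ he)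
    have hmem : ⟨Y ∪ Z, Z⟩ ∈ H.migrations (j + #Z) j X :=
      mem_migrations.2 ⟨mem_nbr.2 ⟨hYZV, he, disjoint_union_right.2 ⟨hXY, hXZ⟩,
        by rw [card_union_of_disjoint hYZ]; lia⟩, subset_union_right, by simp⟩
    exact mem_union_right _ (mem_biUnion.2 ⟨j + #Z, mem_Ioc.2 ⟨by lia, by lia⟩,
      mem_image.2 ⟨_, mem_filter.2 ⟨hmem, hZS⟩, union_sdiff_cancel_right hYZ⟩⟩)

lemma card_nbr_stage_le (hd : H.dim ≤ d) (hXj : #X < j) (S : Finset α) :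
    #((H.stage S).nbr (j - #X) X) ≤
      #(H.nbr (j - #X) X) + ∑ k ∈ Ioc j d, #(H.migrated S k j X) :=
  (card_le_card (nbr_stage_subset hd hXj S)).trans <| (card_union_le _ _).trans <|
    Nat.add_le_add_left (card_biUnion_le.trans (sum_le_sum fun _ _ => card_image_le)) _

lemma increase_le_sum_rpow (hd : H.dim ≤ d) (hXj : #X < j) (S : Finset α) :
    H.increase S j X ≤
      ∑ k ∈ Ioc j d, (#(H.migrated S k j X) : ℝ) ^ (1 / ((j - #X : ℕ) : ℝ)) := by
  have hr0 : 0 < 1 / ((j - #X : ℕ) : ℝ) := one_div_pos.2 (Nat.cast_pos.2 (by lia))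
  have hr1 : 1 / ((j - #X : ℕ) : ℝ) ≤ 1 :=
    (div_le_one (one_div_pos.1 hr0)).2 (Nat.one_le_cast.2 (by lia))
  have hdeg : (H.stage S).normDeg (j - #X) X ≤ H.normDeg (j - #X) X +
      ∑ k ∈ Ioc j d, (#(H.migrated S k j X) : ℝ≥0) ^ (1 / ((j - #X : ℕ) : ℝ)) := by
    unfold normDeg
    generalize 1 / ((j - #X : ℕ) : ℝ) = r at hr0 hr1
    have hsubadd (x y : ℝ≥0) : (x + y) ^ r ≤ x ^ r + y ^ r :=
      NNReal.rpow_add_le_add_rpow x y hr0.le hr1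
    calc (#((H.stage S).nbr (j - #X) X) : ℝ≥0) ^ r
        ≤ (#(H.nbr (j - #X) X) + ∑ k ∈ Ioc j d, (#(H.migrated S k j X) : ℝ≥0)) ^ r :=
          NNReal.rpow_le_rpow (mod_cast card_nbr_stage_le hd hXj S) hr0.le
      _ ≤ (#(H.nbr (j - #X) X) : ℝ≥0) ^ r + (∑ k ∈ Ioc j d, (#(H.migrated S k j X) : ℝ≥0)) ^ r :=
          hsubadd _ _
      _ ≤ _ := by
          gcongr
          exact le_sum_of_subadditive (· ^ r) (NNReal.zero_rpow hr0.ne').le hsubadd _ _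
  rw [increase, sub_le_iff_le_add']
  simpa only [NNReal.coe_add, NNReal.coe_sum, NNReal.coe_rpow, NNReal.coe_natCast] using
    NNReal.coe_le_coe.2 hdeg

end Migration

section Overflow

variable {α : Type*} [DecidableEq α] {H : FinHypergraph α} {d j k n : ℕ} {p R : ℝ}
  {X S : Finset α}

/-- The event, for the set `S` of marked vertices, that the number of edges of size `k` which can
migrate to edges of size `j` containing `X` is at least `R ^ (k - j)` times
`Δ_k ^ (j - #X)`, the bound on its partial expectations. -/
def Overflow (H : FinHypergraph α) (R : ℝ) (k j : ℕ) (X S : Finset α) : Prop :=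
  (H.maxDeg k : ℝ) ^ (j - #X) * R ^ (k - j) ≤ #(H.migrated S k j X)

lemma subsetProb_overflow_le (hp : p ∈ Set.Icc 0 1) (hpk : p * (k * H.maxDeg k) ≤ 1)
    (hX : X ⊆ H.verts) (hXne : X.Nonempty) (hXj : #X < j) (hjk : j < k)
    (hpos : 0 < H.maxDeg k) (hR : 0 < R) :
    subsetProb H.verts p (H.Overflow R k j X) ≤ Real.exp (k - R / Real.exp 1) := by
  have hkj : ((k - j : ℕ) : ℝ) ≤ k := Nat.cast_le.2 (Nat.sub_le k j)
  exact ((partialExpBounded_migrations hp.1 hpk hX hXne hXj hjk.le).subsetProb_le_exp_sub hp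
    (by lia) (by positivity) hR).trans (Real.exp_le_exp.2 (by linarith))

lemma rpow_card_migrated_lt (hR : 1 ≤ R) (hXj : #X < j) (h : ¬ H.Overflow R k j X S) :
    (#(H.migrated S k j X) : ℝ) ^ (1 / ((j - #X : ℕ) : ℝ)) < R ^ (k - j) * H.maxDeg k := by
  have hr : j - #X ≠ 0 := by lia
  rw [one_div, Real.rpow_inv_lt_iff_of_pos (by positivity) (by positivity) (by positivity),
    Real.rpow_natCast]
  calc (#(H.migrated S k j X) : ℝ) < (H.maxDeg k : ℝ) ^ (j - #X) * R ^ (k - j) := not_le.1 h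
    _ ≤ (H.maxDeg k : ℝ) ^ (j - #X) * (R ^ (k - j)) ^ (j - #X) := by
        gcongr
        exact le_self_pow₀ (one_le_pow₀ hR) hr
    _ = (R ^ (k - j) * H.maxDeg k) ^ (j - #X) := by rw [mul_pow, mul_comm]

lemma migrations_eq_empty_of_maxDeg_eq_zero (hX : X ⊆ H.verts) (hXne : X.Nonempty) (hXk : #X < k)
    (h : H.maxDeg k = 0) : H.migrations k j X = ∅ := by
  have hnbr : H.nbr (k - #X) X = ∅ := by
    rw [← not_nonempty_iff_eq_empty]
    intro hne
    have := (one_le_normDeg hne).trans (normDeg_le_maxDeg hX hXne hXk)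
    exact absurd (h ▸ this) (by norm_num)
  rw [migrations, hnbr]
  rfl

lemma rpow_card_migrated_le (hR : 1 ≤ R) (hX : X ⊆ H.verts) (hXne : X.Nonempty) (hXj : #X < j)
    (hjk : j < k) (h : 0 < H.maxDeg k → ¬ H.Overflow R k j X S) :
    (#(H.migrated S k j X) : ℝ) ^ (1 / ((j - #X : ℕ) : ℝ)) ≤ R ^ (k - j) * H.maxDeg k := by
  rcases (zero_le (a := H.maxDeg k)).eq_or_lt with h0 | hpos
  · have hr : j - #X ≠ 0 := by lia
    rw [migrated, migrations_eq_empty_of_maxDeg_eq_zero hX hXne (hXj.trans hjk) h0.symm,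
      filter_empty, card_empty, Nat.cast_zero, Real.zero_rpow (by positivity)]
    positivity
  · exact (rpow_card_migrated_lt hR hXj (h hpos)).le

lemma increase_le_and_lt_migrationBound (hd : H.dim ≤ d) (hn : 1 ≤ Real.log n)
    (hX : X ⊆ H.verts) (hXne : X.Nonempty) (hXj : #X < j)
    (h : ∀ k ∈ Ioc j d, 0 < H.maxDeg k → ¬ H.Overflow (Real.log n ^ 2) k j X S) :
    H.increase S j X ≤ H.migrationBound n d j ∧
      (0 < H.migrationBound n d j → H.increase S j X < H.migrationBound n d j) := by
  have hR : 1 ≤ Real.log n ^ 2 := one_le_pow₀ hn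
  have hincrease := increase_le_sum_rpow hd hXj S
  have hterm : ∀ k ∈ Ioc j d, (#(H.migrated S k j X) : ℝ) ^ (1 / ((j - #X : ℕ) : ℝ)) ≤
      (Real.log n ^ 2) ^ (k - j) * H.maxDeg k := fun k hk =>
    rpow_card_migrated_le hR hX hXne hXj (mem_Ioc.1 hk).1 (h k hk)
  simp only [migrationBound, pow_mul]
  refine ⟨hincrease.trans (sum_le_sum hterm), fun hpos => ?_⟩
  obtain ⟨k, hk, hkpos⟩ : ∃ k ∈ Ioc j d, 0 < (Real.log n ^ 2) ^ (k - j) * (H.maxDeg k : ℝ) := by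
    contrapose! hpos
    exact sum_nonpos hpos
  have hmax : 0 < H.maxDeg k := NNReal.coe_pos.1 (pos_of_mul_pos_right hkpos (by positivity))
  exact hincrease.trans_lt
    (sum_lt_sum hterm ⟨k, hk, rpow_card_migrated_lt hR hXj (h k hk hmax)⟩)

end Overflow

section UnionBound

variable {α : Type*} [DecidableEq α] {H : FinHypergraph α} {d n : ℕ} {p : ℝ}

/-- The triples `(j, k, X)` with `0 < #X < j < k ≤ d` for which edges of size `k` can migrate to
edges of size `j` containing `X`. -/
noncomputable def migrationTriples (H : FinHypergraph α) (d : ℕ) : Finset (ℕ × ℕ × Finset α) :=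
  {b ∈ range (d + 1) ×ˢ range (d + 1) ×ˢ {X ∈ H.verts.powerset | #X ≤ d} |
    b.2.2.Nonempty ∧ #b.2.2 < b.1 ∧ b.1 < b.2.1 ∧ 0 < H.maxDeg b.2.1}

lemma mem_migrationTriples {j k : ℕ} {X : Finset α} :
    (j, k, X) ∈ H.migrationTriples d ↔
      X ⊆ H.verts ∧ X.Nonempty ∧ #X < j ∧ j < k ∧ k ≤ d ∧ 0 < H.maxDeg k := by
  simp only [migrationTriples, mem_filter, mem_product, mem_range, mem_powerset]
  constructor
  · rintro ⟨⟨-, hk, hX, -⟩, hXne, hXj, hjk, hpos⟩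
    exact ⟨hX, hXne, hXj, hjk, by lia, hpos⟩
  · rintro ⟨hX, hXne, hXj, hjk, hkd, hpos⟩
    exact ⟨⟨by lia, by lia, hX, by lia⟩, hXne, hXj, hjk, hpos⟩

lemma card_migrationTriples_le (H : FinHypergraph α) (d : ℕ) :
    #(H.migrationTriples d) ≤ (d + 1) * ((d + 1) * (#H.verts + 1) ^ d) := by
  refine (card_filter_le _ _).trans ?_
  rw [card_product, card_product, card_range]
  gcongr
  exact card_powerset_filter_card_le _ _

lemma union_bound_le_rpow (hd1 : 1 ≤ d) (hd : (d : ℝ) ≤ Real.log n / 8) :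
    (d + 1) * ((d + 1) * (n + 1 : ℝ) ^ d) * Real.exp (d - Real.log n ^ 2 / Real.exp 1) ≤
      (n : ℝ) ^ (-(1 / 8 * Real.log n)) := by
  set L := Real.log n with hL
  have hd1' : (1 : ℝ) ≤ d := by exact_mod_cast hd1
  have hL8 : 8 ≤ L := by linarith
  have hn : (1 : ℝ) ≤ n := by
    rw [Nat.one_le_cast, Nat.one_le_iff_ne_zero]
    rintro rfl
    norm_num [hL] at hL8
  have hnexp : (n + 1 : ℝ) ≤ Real.exp (L + 1) := by
    rw [Real.exp_add, hL, Real.exp_log (by linarith)]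
    nlinarith [Real.exp_one_gt_two]
  have hdexp : (d + 1 : ℝ) ≤ Real.exp d := Real.add_one_le_exp _
  have he : L ^ 2 / 3 ≤ L ^ 2 / Real.exp 1 := by
    gcongr
    exact Real.exp_one_lt_three.le
  calc _ ≤ Real.exp d * (Real.exp d * Real.exp (L + 1) ^ d) *
        Real.exp (d - L ^ 2 / Real.exp 1) := by gcongr
    _ = Real.exp (d * L + 4 * d - L ^ 2 / Real.exp 1) := by
        rw [← Real.exp_nat_mul, ← Real.exp_add, ← Real.exp_add, ← Real.exp_add]
        ring_nf
    _ ≤ Real.exp (L * -(1 / 8 * L)) := by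
        gcongr
        nlinarith
    _ = (n : ℝ) ^ (-(1 / 8 * L)) := (Real.rpow_def_of_pos (by linarith) _).symm

lemma sum_subsetProb_overflow_le (hd : (d : ℝ) ≤ Real.log n / 8) (hp : p ∈ Set.Icc 0 1)
    (hpdim : p * (H.dim * H.totalMaxDeg) ≤ 1) (hV : #H.verts ≤ n) :
    ∑ b ∈ H.migrationTriples d,
        subsetProb H.verts p (H.Overflow (Real.log n ^ 2) b.2.1 b.1 b.2.2) ≤
      (n : ℝ) ^ (-(1 / 8 * Real.log n)) := by
  rcases (H.migrationTriples d).eq_empty_or_nonempty with hempty | ⟨⟨j₀, k₀, X₀⟩, hmem₀⟩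
  · rw [hempty, sum_empty]
    positivity
  have hd1 : 1 ≤ d := by
    have := mem_migrationTriples.1 hmem₀
    lia
  have hlog : 0 < Real.log n := by
    have : (1 : ℝ) ≤ d := by exact_mod_cast hd1
    linarith
  have hprob : ∀ b ∈ H.migrationTriples d,
      subsetProb H.verts p (H.Overflow (Real.log n ^ 2) b.2.1 b.1 b.2.2) ≤
        Real.exp (d - Real.log n ^ 2 / Real.exp 1) := by
    rintro ⟨j, k, X⟩ hb
    obtain ⟨hX, hXne, hXj, hjk, hkd, hpos⟩ := mem_migrationTriples.1 hb
    have hpk : p * (k * H.maxDeg k) ≤ 1 :=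
      (mul_le_mul_of_nonneg_left (mul_maxDeg_le_dim_mul_totalMaxDeg (by lia)) hp.1).trans hpdim
    refine (subsetProb_overflow_le hp hpk hX hXne hXj hjk hpos (by positivity)).trans ?_
    gcongr
  have hcard : (#(H.migrationTriples d) : ℝ) ≤ (d + 1) * ((d + 1) * (n + 1 : ℝ) ^ d) := by
    have hVpow := Nat.pow_le_pow_left (Nat.add_le_add_right hV 1) d
    exact_mod_cast (card_migrationTriples_le H d).trans (by gcongr)
  calc _ ≤ #(H.migrationTriples d) * Real.exp (d - Real.log n ^ 2 / Real.exp 1) := by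
        simpa only [nsmul_eq_mul] using sum_le_card_nsmul _ _ _ hprob
    _ ≤ _ := mul_le_mul_of_nonneg_right hcard (Real.exp_pos _).le
    _ ≤ _ := union_bound_le_rpow hd1 hd

lemma markProb_eq_subsetProb (H : FinHypergraph α) (p : ℝ) (P : Finset α → Prop) :
    H.markProb p P = subsetProb H.verts p P := by
  simp only [markProb, subsetProb, subsetExp, mul_ite, mul_one, mul_zero, sum_filter]

end UnionBound

section MarkingProbability

variable {α : Type*} [DecidableEq α] {H : FinHypergraph α} {a : ℝ}

lemma one_div_mul_totalMaxDeg_mem_Icc (ha : H.dim ≤ a) :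
    1 / (a * H.totalMaxDeg) ∈ Set.Icc (0 : ℝ) 1 := by
  have ha0 : 0 ≤ a := (Nat.cast_nonneg _).trans ha
  refine ⟨by positivity, ?_⟩
  rcases (zero_le (a := H.totalMaxDeg)).eq_or_lt with h0 | hpos
  · simp [← h0]
  · have h1 : 1 ≤ a * H.totalMaxDeg := (one_le_dim_mul_totalMaxDeg hpos).trans (by gcongr)
    exact div_le_one_of_le₀ h1 (by positivity)

lemma one_div_mul_totalMaxDeg_mul_le_one (ha : H.dim ≤ a) :
    1 / (a * H.totalMaxDeg) * (H.dim * H.totalMaxDeg) ≤ 1 := by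
  have ha0 : 0 ≤ a := (Nat.cast_nonneg _).trans ha
  rw [one_div_mul_eq_div]
  exact div_le_one_of_le₀ (by gcongr) (by positivity)

end MarkingProbability

end FinHypergraph

lemma eventually_loglog_div_logloglog_le : ∀ᶠ n : ℕ in Filter.atTop,
    Real.log (Real.log n) / (4 * Real.log (Real.log (Real.log n))) ≤ Real.log n / 8 := by
  have hlog : Filter.Tendsto (fun n : ℕ => Real.log n) Filter.atTop Filter.atTop :=
    Real.tendsto_log_atTop.comp tendsto_natCast_atTop_atTop
  have hloglog := Real.tendsto_log_atTop.comp hlog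
  have hlogloglog := Real.tendsto_log_atTop.comp hloglog
  filter_upwards [hlog.eventually_ge_atTop 0, hloglog.eventually_ge_atTop 0,
    hlogloglog.eventually_ge_atTop 2] with n h1 h2 h3
  simp only [Function.comp_apply] at h2 h3
  calc _ ≤ Real.log (Real.log n) / (4 * 2) := by gcongr
    _ ≤ Real.log n / (4 * 2) :=
        div_le_div_of_nonneg_right (Real.log_le_self h1) (by norm_num)
    _ = Real.log n / 8 := by norm_num

theorem mainTheorem4_general {α : Type*} [DecidableEq α] {H : FinHypergraph α} {n d : ℕ} {p : ℝ}
    (hd : (d : ℝ) ≤ Real.log n / 8) (hp : p ∈ Set.Icc 0 1)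
    (hpdim : p * (H.dim * H.totalMaxDeg) ≤ 1) (hV : H.verts.card ≤ n) (hdim : H.dim ≤ d) :
    1 - (n : ℝ) ^ (-(1 / 8 * Real.log n)) ≤
      H.markProb p fun S =>
        ∀ j : ℕ, 2 ≤ j → j ≤ d →
        ∀ X : Finset α, X ⊆ H.verts → X.Nonempty → X.card < j →
          H.increase S j X ≤ H.migrationBound n d j ∧
          (0 < H.migrationBound n d j → H.increase S j X < H.migrationBound n d j) := by
  rw [FinHypergraph.markProb_eq_subsetProb]
  refine ((sub_le_sub_left (FinHypergraph.sum_subsetProb_overflow_le hd hp hpdim hV) 1).trans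
    (one_sub_sum_subsetProb_le hp _ _)).trans (subsetProb_mono hp ?_)
  intro S hS j hj hjd X hX hXne hXj
  have hlog : 1 ≤ Real.log n := by
    have : (2 : ℝ) ≤ d := by exact_mod_cast hj.trans hjd
    linarith
  refine FinHypergraph.increase_le_and_lt_migrationBound hdim hlog hX hXne hXj fun k hk hpos => ?_
  obtain ⟨hjk, hkd⟩ := Finset.mem_Ioc.1 hk
  exact hS (j, k, X) (FinHypergraph.mem_migrationTriples.2 ⟨hX, hXne, hXj, hjk, hkd, hpos⟩)

lemma natCast_le_of_marking_constant {d : ℕ} {a : ℝ} (ha : a = 2 ^ (d + 1) ∨ a = 5 * d) :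
    (d : ℝ) ≤ a := by
  rcases ha with rfl | rfl
  · exact_mod_cast (Nat.lt_two_pow_self.trans (Nat.pow_lt_pow_succ one_lt_two)).le
  · linarith [(Nat.cast_nonneg d : (0 : ℝ) ≤ d)]

theorem mainTheorem4 :
    ∃ c : ℝ, 0 < c ∧ ∃ n₀ : ℕ, ∀ n : ℕ, n₀ ≤ n →
      ∀ d : ℕ, (d : ℝ) ≤ Real.log (Real.log n) / (4 * Real.log (Real.log (Real.log n))) →
      ∀ a : ℝ, a = 2 ^ (d + 1) ∨ a = 5 * d →
      ∀ (α : Type*) [DecidableEq α] (H : FinHypergraph α),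
        H.verts.card ≤ n → H.dim ≤ d →
        1 - (n : ℝ) ^ (-(c * Real.log n)) ≤
          H.markProb (1 / (a * (H.totalMaxDeg : ℝ))) fun S =>
            ∀ j : ℕ, 2 ≤ j → j ≤ d →
            ∀ X : Finset α, X ⊆ H.verts → X.Nonempty → X.card < j →
              H.increase S j X ≤ H.migrationBound n d j ∧
              (0 < H.migrationBound n d j → H.increase S j X < H.migrationBound n d j) := by
  obtain ⟨n₀, hn₀⟩ := Filter.eventually_atTop.1 eventually_loglog_div_logloglog_le
  refine ⟨1 / 8, by norm_num, n₀, fun n hn d hd a ha α _ H hV hdim => ?_⟩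
  have hda : (H.dim : ℝ) ≤ a := (Nat.cast_le.2 hdim).trans (natCast_le_of_marking_constant ha)
  exact mainTheorem4_general (hd.trans (hn₀ n hn))
    (FinHypergraph.one_div_mul_totalMaxDeg_mem_Icc hda)
    (FinHypergraph.one_div_mul_totalMaxDeg_mul_le_one hda) hV hdim
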